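/- Let $\alpha \in (0,2)$ and $m_\xi \in [0,1)$ (the offspring mean of a subcritical Galton–Watson process with immigration whose immigration distribution is regularly varying with index $\alpha$). For $K \in \mathbb{Z}_+$ let $$v_0^{(K)} := (1-m_\xi^\alpha)^{-1/\alpha}\,(1, m_\xi, m_\xi^2, \ldots, m_\xi^K)^\top, \qquad v_j^{(K)} := (\underbrace{0,\ldots,0}_{j}, 1, m_\xi, \ldots, m_\xi^{K-j})^\top \quad (1 \le j \le K),$$ with the convention $0^0 := 1$, and let $\mu_{K,\alpha}$ be the ($\alpha$-stable) probability measure on $\mathbb{R}^{K+1}$ with characteristic function $$\widehat{\mu_{K,\alpha}}(\theta) = \exp\biggl\{(1-m_\xi^\alpha)\sum_{j=0}^K \int_0^\infty \biggl(e^{i\langle\theta,v_j^{(K)}\rangle u} - 1 - i u \sum_{\ell=1}^{K+1} \theta_\ell\, (v_j^{(K)})_\ell\, \mathbf{1}_{(0,1]}\bigl(u (v_j^{(K)})_\ell\bigr)\biggr)\,\alpha u^{-1-\alpha}\,du\biggr\}, \qquad \theta \in \mathbb{R}^{K+1}.$$ ($\mu_{K,\alpha}$ is the law at time $1$ of the limit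 process of the centered and scaled partial sums of independent copies of the segment $(X_0,\ldots,X_K)$ of the stationary Galton–Watson process with immigration.) Let $(\mathcal{Y}^{(\alpha)}_k)_{k\in\mathbb{Z}_+}$ be a real-valued process such that, for each $K \in \mathbb{Z}_+$, the random vector $(\mathcal{Y}^{(\alpha)}_0, \ldots, \mathcal{Y}^{(\alpha)}_K)^\top$ has law $\mu_{K,\alpha}$. Then $(\mathcal{Y}^{(\alpha)}_k)_{k\in\mathbb{Z}_+}$ is a subcritical autoregressive process of order 1 with autoregressive coefficient $m_\xi$ and $\alpha$-stable innovations, namely $$\mathcal{Y}^{(\alpha)}_k = m_\xi\, \mathcal{Y}^{(\alpha)}_{k-1} + \widetilde\varepsilon^{(\alpha)}_k, \qquad k \in \mathbb{N},$$ where the random variables $\widetilde\varepsilon^{(\alpha)}_k := \mathcal{Y}^{(\alpha)}_k - m_\xi\, \mathcal{Y}^{(\alpha)}_{k-1}$, $k \in \mathbb{N}$, are independent, identically distributed and $\alpha$-stable, and, for every $k \in \mathbb{N}$, $\widetilde\varepsilon^{(\alpha)}_k$ is independent of $(\mathcal{Y}^{(\alpha)}_0, \ldots, \mathcal{Y}^{(\alpha)}_{k-1})^\top$.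 Moreover, $(\mathcal{Y}^{(\alpha)}_k)_{k\in\mathbb{Z}_+}$ is a strongly stationary, time homogeneous Markov process. Here a probability law $\rho$ on $\mathbb{R}$ is called $\alpha$-stable if it is not a Dirac measure and, for all $a,b>0$, there is $c\in\mathbb{R}$ such that $aZ_1 + bZ_2$ and $(a^\alpha+b^\alpha)^{1/\alpha} Z + c$ have the same law, where $Z_1, Z_2$ are independent and $Z_1, Z_2, Z$ have law $\rho$. -/

import Mathlib

open MeasureTheory ProbabilityTheory

open scoped RealInnerProductSpace

noncomputable section

namespace GWIAggregation

/-- The vector `v_j^{(K)} ∈ ℝ^{K+1}`, with coordinates indexed by `0, …, K`: its coordinates vanish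
below `j`, the `i`-th one is `m ^ (i - j)` for `i ≥ j`, and for `j = 0` the whole vector is multiplied
by `(1 - m ^ α) ^ (-1 / α)`. -/
def v (α m : ℝ) (K : ℕ) (j : Fin (K + 1)) : EuclideanSpace ℝ (Fin (K + 1)) :=
  WithLp.toLp 2 fun i =>
    (if j = 0 then (1 - m ^ α) ^ (-1 / α) else 1) *
      (if j ≤ i then m ^ ((i : ℕ) - (j : ℕ)) else 0)

/-- The Lévy–Khintchine integrand
`(e^{i⟨θ, v⟩u} - 1 - i u ∑_ℓ θ_ℓ v_ℓ 1_{(0,1]}(u v_ℓ)) α u^{-1-α}` with coordinatewise truncation.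
The coordinates on which `v` vanishes do not contribute to the sum. -/
def levyIntegrand (α : ℝ) {d : ℕ} (θ w : EuclideanSpace ℝ (Fin d)) (u : ℝ) : ℂ :=
  (Complex.exp (Complex.I * ((⟪θ, w⟫ * u : ℝ) : ℂ)) - 1
      - Complex.I * ((u * ∑ l, θ l * w l * (Set.Ioc (0 : ℝ) 1).indicator 1 (u * w l) : ℝ) : ℂ))
    * ((α * u ^ (-1 - α) : ℝ) : ℂ)

/-- The characteristic function of the law `μ_{K,α}` of the `α`-stable limit vector
`𝒳_1^{(K,α)}` in `ℝ^{K+1}`. -/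
def limitCharFun (α m : ℝ) (K : ℕ) (θ : EuclideanSpace ℝ (Fin (K + 1))) : ℂ :=
  Complex.exp (((1 - m ^ α : ℝ) : ℂ) *
    ∑ j : Fin (K + 1), ∫ u in Set.Ioi (0 : ℝ), levyIntegrand α θ (v α m K j) u)

/-- `Y = (Y_k)_{k ≥ 0}` is a version of the limit process: for each `K`, the law of
`(Y_0, …, Y_K)` is `μ_{K,α}`, the probability measure on `ℝ^{K+1}` with characteristic function
`limitCharFun α m K`. -/
structure IsLimitProcess {Ω : Type*} [MeasurableSpace Ω] (P : Measure Ω) (α m : ℝ)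
    (Y : ℕ → Ω → ℝ) : Prop where
  measurable : ∀ k, Measurable (Y k)
  charFun_eq : ∀ (K : ℕ) (θ : EuclideanSpace ℝ (Fin (K + 1))),
    charFun (P.map fun ω => WithLp.toLp 2 fun i : Fin (K + 1) => Y i ω) θ = limitCharFun α m K θ

/-- A probability measure `ρ` on `ℝ` is `α`-stable if it is nondegenerate and, for independent
`Z₁, Z₂, Z` with law `ρ` and all `a, b > 0`, the variable `a Z₁ + b Z₂` has the law of
`(a ^ α + b ^ α) ^ (1 / α) Z + c` for some real `c`. -/
def IsAlphaStable (α : ℝ) (ρ : Measure ℝ) : Prop :=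
  IsProbabilityMeasure ρ ∧ (∀ x : ℝ, ρ ≠ Measure.dirac x) ∧
    ∀ a b : ℝ, 0 < a → 0 < b → ∃ c : ℝ,
      Measure.conv (ρ.map fun x => a * x) (ρ.map fun x => b * x) =
        ρ.map fun x => (a ^ α + b ^ α) ^ (1 / α) * x + c

/-- Strong stationarity: every time shift of the process has the same law on the path space. -/
def IsStronglyStationary {Ω : Type*} [MeasurableSpace Ω] (P : Measure Ω) (Y : ℕ → Ω → ℝ) : Prop :=
  ∀ h : ℕ, IdentDistrib (fun ω k => Y (k + h) ω) (fun ω k => Y k ω) P P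

/-- The σ-algebra generated by `Y_0, …, Y_k`. -/
abbrev past {Ω : Type*} (Y : ℕ → Ω → ℝ) (k : ℕ) : MeasurableSpace Ω :=
  MeasurableSpace.comap (fun ω (i : Fin (k + 1)) => Y i ω) inferInstance

/-- `Y` is a time homogeneous Markov process (with respect to its natural filtration): one transition
kernel `κ` satisfies `P(Y_{k+1} ∈ B | Y_0, …, Y_k) = κ(Y_k, B)` almost surely for all times `k`. -/
def IsTimeHomogeneousMarkov {Ω : Type*} [MeasurableSpace Ω] (P : Measure Ω)
    (Y : ℕ → Ω → ℝ) : Prop :=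
  ∃ κ : Kernel ℝ ℝ, IsMarkovKernel κ ∧ ∀ (k : ℕ) (B : Set ℝ), MeasurableSet B →
    P[(Y (k + 1) ⁻¹' B).indicator (fun _ => (1 : ℝ)) | past Y k]
      =ᵐ[P] fun ω => (κ (Y k ω)).real B

/-- The innovation `ε̃_k = Y_k - m Y_{k-1}`, used for `k ≥ 1` only. -/
def innovation {Ω : Type*} (m : ℝ) (Y : ℕ → Ω → ℝ) (k : ℕ) (ω : Ω) : ℝ :=
  Y k ω - m * Y (k - 1) ω

end GWIAggregation

end

/-!
For a vector `w` with nonnegative coordinates, let `I(θ, w)` be the integral of `levyIntegrand α θ w`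
over `(0, ∞)`; up to the factor `1 - m ^ α`, the exponent of the law of `(Y_0, …, Y_K)` is the sum of
the `I(θ, v_j)`. Two properties of `I` carry the argument.

* `integral_levyIntegrand_smul`: the coordinatewise truncation depends on `u` and `w` only through
  `u w`, so the substitution `u ↦ c u` gives `I(θ, c w) = c ^ α I(θ, w)`, with no drift.
* `integral_levyIntegrand`: replacing the coordinatewise truncation by the truncation at `u ≤ 1` costs
  a linear drift, so `I(θ, w) = ψ(⟪θ, w⟫) + i ∑ θ_l κ(w_l)`, where `ψ` is `stableExponent α` and `κ` is
  `drift α`.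

Stationarity follows from the first one. Deleting the coordinate `0` in dimension `K + 2` turns `v_0`
into `m v_0`, turns `v_1` into `(1 - m ^ α) ^ (1 / α) v_0`, and turns the remaining vectors into
`v_1, …, v_K`. Since `m ^ α + (1 - m ^ α) = 1`, the vectors `(Y_1, …, Y_{K+1})` and `(Y_0, …, Y_K)`
have the same law (`limitCharFun_cons_zero`).

The independence of an innovation from the past follows from the second one. The vectors
`v_0, …, v_n` of dimension `n + 2` satisfy `z_{n+1} = m z_n`, so that they do not see the variable
`z_{n+1} - m z_n` except through the drift, while `v_{n+1}` is the last unit vector. Hence the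
characteristic function of `(Y_0, …, Y_n)` and the innovation at time `n + 1` factorizes
(`limitCharFun_splitFreq`), and the innovation has the exponent `(1 - m ^ α) (ψ(s) + i s D)`. Its
stability is the homogeneity of `ψ` up to a drift (`stableExponent_mul`), and its nondegeneracy
is `re_stableExponent_one_neg`. The remaining claims are consequences of strong stationarity and of the
independence of each innovation from the past.
-/

noncomputable section

namespace GWIAggregation

open Set

/-! ### Splitting the Lévy–Khintchine integral -/

/-- The one-dimensional Lévy–Khintchine integrand with truncation on `u ≤ 1`. -/
def stableIntegrand (α x u : ℝ) : ℂ :=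
  (Complex.exp (Complex.I * ((x * u : ℝ) : ℂ)) - 1
      - Complex.I * ((x * u * (Ioc (0 : ℝ) 1).indicator 1 u : ℝ) : ℂ))
    * ((α * u ^ (-1 - α) : ℝ) : ℂ)

/-- The exponent `∫₀^∞ (e^{ixu} - 1 - ixu 1_{(0,1]}(u)) α u^{-1-α} du` of a one-sided
`α`-stable law on `ℝ`. -/
def stableExponent (α x : ℝ) : ℂ := ∫ u in Ioi (0 : ℝ), stableIntegrand α x u

/-- The density of the drift that arises when the truncation at `u ≤ 1` is replaced by the truncation
at `u w ≤ 1`. -/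
def driftIntegrand (α w u : ℝ) : ℝ :=
  w * ((Ioc (0 : ℝ) 1).indicator 1 u - (Ioc (0 : ℝ) 1).indicator 1 (u * w)) *
    (u * (α * u ^ (-1 - α)))

/-- The drift that arises when the truncation at `u ≤ 1` is replaced by the truncation at
`u w ≤ 1`. -/
def drift (α w : ℝ) : ℝ := ∫ u in Ioi (0 : ℝ), driftIntegrand α w u

lemma norm_exp_sub_one_sub_le_sq (y : ℝ) :
    ‖Complex.exp (Complex.I * y) - 1 - Complex.I * y‖ ≤ 3 * y ^ 2 := by
  have hn : ‖Complex.I * (y : ℂ)‖ = |y| := by simp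
  rcases le_or_gt |y| 1 with h | h
  · have := Complex.norm_exp_sub_one_sub_id_le (x := Complex.I * y) (by rw [hn]; exact h)
    rw [hn, sq_abs] at this
    nlinarith [sq_nonneg y]
  · have h1 := Real.norm_exp_I_mul_ofReal_sub_one_le (x := y)
    rw [Real.norm_eq_abs] at h1
    have h2 := norm_sub_le (Complex.exp (Complex.I * y) - 1) (Complex.I * y)
    rw [hn] at h2
    nlinarith [sq_abs y]

lemma measurable_indicator_truncation (w : ℝ) :
    Measurable fun u : ℝ => (Ioc (0 : ℝ) 1).indicator (1 : ℝ → ℝ) (u * w) :=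
  (measurable_one.indicator measurableSet_Ioc).comp (measurable_id.mul_const w)

lemma measurable_stableIntegrand (α x : ℝ) : Measurable (stableIntegrand α x) := by
  have := measurable_indicator_truncation 1
  simp only [mul_one] at this
  unfold stableIntegrand
  fun_prop

lemma measurable_driftIntegrand (α w : ℝ) : Measurable (driftIntegrand α w) := by
  have h1 := measurable_indicator_truncation 1
  have h2 := measurable_indicator_truncation w
  simp only [mul_one] at h1
  unfold driftIntegrand
  fun_prop

lemma integrableOn_stableIntegrand {α : ℝ} (hα0 : 0 < α) (hα2 : α < 2) (x : ℝ) :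
    IntegrableOn (stableIntegrand α x) (Ioi 0) := by
  rw [← Ioc_union_Ioi_eq_Ioi (zero_le_one (α := ℝ))]
  refine IntegrableOn.union ?_ ?_
  · have hg : IntegrableOn (fun u : ℝ => 3 * x ^ 2 * α * u ^ (1 - α)) (Ioc 0 1) := by
      have := (intervalIntegral.intervalIntegrable_rpow' (a := 0) (b := 1) (r := 1 - α)
        (by linarith)).1
      exact this.const_mul _
    refine Integrable.mono' hg (measurable_stableIntegrand α x).aestronglyMeasurable ?_
    refine (ae_restrict_iff' measurableSet_Ioc).2 (.of_forall fun u hu => ?_)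
    have hp : (u : ℝ) ^ (1 - α) = u ^ 2 * u ^ (-1 - α) := by
      rw [← Real.rpow_natCast, ← Real.rpow_add hu.1]; congr 1; push_cast; ring
    have h1 := norm_exp_sub_one_sub_le_sq (x * u)
    have h2 : 0 ≤ α * u ^ (-1 - α) := mul_nonneg hα0.le (Real.rpow_nonneg hu.1.le _)
    unfold stableIntegrand
    rw [indicator_of_mem hu, norm_mul, Complex.norm_real, Real.norm_eq_abs, abs_of_nonneg h2,
      Pi.one_apply, mul_one, hp]
    calc _ ≤ 3 * (x * u) ^ 2 * (α * u ^ (-1 - α)) := mul_le_mul_of_nonneg_right h1 h2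
      _ = _ := by ring
  · have hg : IntegrableOn (fun u : ℝ => 2 * α * u ^ (-1 - α)) (Ioi 1) :=
      (integrableOn_Ioi_rpow_of_lt (by linarith) one_pos).const_mul _
    refine Integrable.mono' hg (measurable_stableIntegrand α x).aestronglyMeasurable ?_
    refine (ae_restrict_iff' measurableSet_Ioi).2 (.of_forall fun u hu => ?_)
    have hu1 : (1 : ℝ) < u := hu
    have h1 : ‖Complex.exp (Complex.I * ((x * u : ℝ) : ℂ)) - 1‖ ≤ 2 := by
      refine (norm_sub_le _ _).trans ?_
      rw [Complex.norm_exp_I_mul_ofReal, norm_one]; norm_num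
    have h2 : 0 ≤ α * u ^ (-1 - α) := mul_nonneg hα0.le (Real.rpow_nonneg (by linarith) _)
    unfold stableIntegrand
    rw [indicator_of_notMem (fun h => absurd h.2 (not_le.2 hu1)), norm_mul, Complex.norm_real,
      Real.norm_eq_abs, abs_of_nonneg h2, mul_zero, Complex.ofReal_zero, mul_zero, sub_zero]
    calc _ ≤ 2 * (α * u ^ (-1 - α)) := mul_le_mul_of_nonneg_right h1 h2
      _ = _ := by ring

/-- The two truncations differ only on a compact subinterval of `(0, ∞)`, so no condition on `α` is
needed. -/
lemma integrableOn_driftIntegrand (α : ℝ) {w : ℝ} (hw : 0 ≤ w) :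
    IntegrableOn (driftIntegrand α w) (Ioi 0) := by
  rcases hw.eq_or_lt with rfl | hw
  · have : driftIntegrand α 0 = fun _ => 0 := by ext u; simp [driftIntegrand]
    rw [this]; exact integrableOn_zero
  set a := min 1 w⁻¹
  set b := max 1 w⁻¹
  have ha : 0 < a := lt_min one_pos (inv_pos.2 hw)
  have hg : Integrable ((Icc a b).indicator fun u : ℝ => w * (u * (|α| * u ^ (-1 - α)))) := by
    rw [integrable_indicator_iff measurableSet_Icc]
    refine ContinuousOn.integrableOn_Icc fun u hu => ContinuousAt.continuousWithinAt ?_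
    have : u ≠ 0 := (ha.trans_le hu.1).ne'
    have h := Real.continuousAt_rpow_const u (-1 - α) (Or.inl this)
    fun_prop
  refine Integrable.mono' hg.integrableOn (measurable_driftIntegrand α w).aestronglyMeasurable ?_
  refine (ae_restrict_iff' measurableSet_Ioi).2 (.of_forall fun u hu => ?_)
  have hu0 : (0 : ℝ) < u := hu
  have hw' : u * w ≤ 1 ↔ u ≤ w⁻¹ := (le_inv_mul_iff₀' hw).symm.trans (by rw [mul_one])
  have hi (t : ℝ) (ht : 0 < t) :
      (Ioc (0 : ℝ) 1).indicator (1 : ℝ → ℝ) t = if t ≤ 1 then 1 else 0 := by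
    simp [indicator_apply, ht]
  unfold driftIntegrand
  rw [hi u hu0, hi _ (mul_pos hu0 hw)]
  simp only [hw']
  by_cases hm : u ∈ Icc a b
  · rw [indicator_of_mem hm, norm_mul, norm_mul, norm_mul, norm_mul, Real.norm_of_nonneg hw.le,
      Real.norm_of_nonneg hu0.le, Real.norm_of_nonneg (Real.rpow_nonneg hu0.le _),
      Real.norm_eq_abs α]
    have hd : ‖((if u ≤ 1 then 1 else 0) - if u ≤ w⁻¹ then 1 else 0 : ℝ)‖ ≤ 1 := by
      split_ifs <;> norm_num
    refine mul_le_mul_of_nonneg_right ?_ (by positivity)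
    nlinarith
  · rw [indicator_of_notMem hm]
    have hd : ((if u ≤ 1 then 1 else 0) - if u ≤ w⁻¹ then 1 else 0 : ℝ) = 0 := by
      rcases lt_or_ge u a with h | h
      · have h1 := lt_min_iff.1 h
        rw [if_pos h1.1.le, if_pos h1.2.le, sub_self]
      · have h1 := max_lt_iff.1 (not_le.1 fun h' => hm ⟨h, h'⟩)
        rw [if_neg (not_le.2 h1.1), if_neg (not_le.2 h1.2), sub_self]
    rw [hd]; simp

lemma drift_zero (α : ℝ) : drift α 0 = 0 := by simp [drift, driftIntegrand]

lemma drift_one (α : ℝ) : drift α 1 = 0 := by simp [drift, driftIntegrand]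

/-- The Lévy–Khintchine integral along a vector `w` depends on `θ` through the stable exponent at
`⟪θ, w⟫` and a linear drift. -/
lemma integral_levyIntegrand {α : ℝ} (hα0 : 0 < α) (hα2 : α < 2) {d : ℕ}
    (θ w : EuclideanSpace ℝ (Fin d)) (hw : ∀ l, 0 ≤ w l) :
    ∫ u in Ioi (0 : ℝ), levyIntegrand α θ w u =
      stableExponent α ⟪θ, w⟫ + Complex.I * ((∑ l, θ l * drift α (w l) : ℝ) : ℂ) := by
  have hpt : ∀ u : ℝ, levyIntegrand α θ w u = stableIntegrand α ⟪θ, w⟫ u +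
      Complex.I * ((∑ l, θ l * driftIntegrand α (w l) u : ℝ) : ℂ) := by
    intro u
    have hin : ⟪θ, w⟫ = ∑ l, θ l * w l := by
      simp [PiLp.inner_apply, mul_comm]
    have hsum : ∑ l, θ l * driftIntegrand α (w l) u =
        ((⟪θ, w⟫ * u * (Ioc (0 : ℝ) 1).indicator 1 u) -
          u * ∑ l, θ l * w l * (Ioc (0 : ℝ) 1).indicator 1 (u * w l)) * (α * u ^ (-1 - α)) := by
      rw [hin]
      simp only [Finset.sum_mul, Finset.mul_sum, ← Finset.sum_sub_distrib]
      refine Finset.sum_congr rfl fun l _ => ?_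
      unfold driftIntegrand
      ring
    rw [hsum]
    unfold levyIntegrand stableIntegrand
    push_cast
    ring
  have hint : ∀ l ∈ Finset.univ, Integrable (fun u => θ l * driftIntegrand α (w l) u)
      (volume.restrict (Ioi (0 : ℝ))) :=
    fun l _ => (integrableOn_driftIntegrand α (hw l)).const_mul _
  have hsum : Integrable
      (fun u => Complex.I * ((∑ l, θ l * driftIntegrand α (w l) u : ℝ) : ℂ))
      (volume.restrict (Ioi (0 : ℝ))) :=
    (integrable_finsetSum _ hint).ofReal.const_mul _
  simp_rw [hpt]
  rw [integral_add (integrableOn_stableIntegrand hα0 hα2 _) hsum, integral_const_mul,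
    integral_complex_ofReal, integral_finsetSum _ hint]
  simp_rw [integral_const_mul]
  rfl

/-- Since the truncation in the integrand depends on `u` and `w` only through the product `u w`, the
Lévy–Khintchine integral is homogeneous of degree `α` in `w`, without any drift. -/
lemma integral_levyIntegrand_smul {α : ℝ} (hα0 : 0 < α) {d : ℕ}
    (θ w : EuclideanSpace ℝ (Fin d)) {c : ℝ} (hc : 0 ≤ c) :
    ∫ u in Ioi (0 : ℝ), levyIntegrand α θ (c • w) u =
      ((c ^ α : ℝ) : ℂ) * ∫ u in Ioi (0 : ℝ), levyIntegrand α θ w u := by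
  rcases hc.eq_or_lt with rfl | hc
  · simp [levyIntegrand, Real.zero_rpow hα0.ne']
  have hpt : ∀ u ∈ Ioi (0 : ℝ), levyIntegrand α θ (c • w) u =
      ((c ^ (1 + α) : ℝ) : ℂ) * levyIntegrand α θ w (c * u) := by
    intro u hu
    have hu0 : (0 : ℝ) < u := hu
    have hpow : c ^ (1 + α) * (α * (c * u) ^ (-1 - α)) = α * u ^ (-1 - α) := by
      rw [Real.mul_rpow hc.le hu0.le]
      have : c ^ (1 + α) * c ^ (-1 - α) = 1 := by
        rw [← Real.rpow_add hc]; ring_nf; exact Real.rpow_zero c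
      linear_combination (α * u ^ (-1 - α)) * this
    unfold levyIntegrand
    rw [← hpow, inner_smul_right, Finset.mul_sum, Finset.mul_sum]
    have hs : ∀ l, u * (θ l * (c • w) l * (Ioc (0 : ℝ) 1).indicator 1 (u * (c • w) l)) =
        c * u * (θ l * w l * (Ioc (0 : ℝ) 1).indicator 1 (c * u * w l)) := by
      intro l
      rw [PiLp.smul_apply, smul_eq_mul, show u * (c * w l) = c * u * w l by ring]
      ring
    simp_rw [hs]
    push_cast
    ring_nf
  rw [setIntegral_congr_fun measurableSet_Ioi hpt, integral_const_mul,
    integral_comp_mul_left_Ioi (fun u => levyIntegrand α θ w u) 0 hc, mul_zero,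
    Complex.real_smul, ← mul_assoc, ← Complex.ofReal_mul, Real.rpow_add hc, Real.rpow_one,
    mul_right_comm, mul_inv_cancel₀ hc.ne', one_mul]

/-- The stable exponent is homogeneous of degree `α` up to a linear drift. -/
lemma stableExponent_mul {α : ℝ} (hα0 : 0 < α) (hα2 : α < 2) {c : ℝ} (hc : 0 ≤ c) (x : ℝ) :
    stableExponent α (c * x) =
      ((c ^ α : ℝ) : ℂ) * stableExponent α x - Complex.I * ((x * drift α c : ℝ) : ℂ) := by
  have h := integral_levyIntegrand_smul hα0 (WithLp.toLp 2 fun _ : Fin 1 => x)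
    (WithLp.toLp 2 fun _ => 1) hc
  rw [integral_levyIntegrand hα0 hα2 _ _ (by simpa using hc),
    integral_levyIntegrand hα0 hα2 _ _ (by simp)] at h
  simp only [PiLp.inner_apply, PiLp.smul_apply, Fin.sum_univ_one, RCLike.inner_apply, conj_trivial,
    smul_eq_mul, mul_one, one_mul, drift_one, mul_zero, Complex.ofReal_zero, add_zero] at h
  rw [← h]
  ring

/-- The real part of the integrand is `(cos u - 1) α u^{-1-α} ≤ 0`, which vanishes only on a null
set. -/
lemma re_stableExponent_one_neg {α : ℝ} (hα0 : 0 < α) (hα2 : α < 2) :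
    (stableExponent α 1).re < 0 := by
  have hint := integrableOn_stableIntegrand hα0 hα2 1
  have hre : ∀ u : ℝ, (stableIntegrand α 1 u).re = (Real.cos u - 1) * (α * u ^ (-1 - α)) := by
    intro u
    unfold stableIntegrand
    rw [Complex.re_mul_ofReal, mul_comm Complex.I, Complex.sub_re, Complex.sub_re,
      Complex.exp_ofReal_mul_I_re]
    simp
  have hneg : (stableExponent α 1).re =
      -∫ u in Ioi (0 : ℝ), (1 - Real.cos u) * (α * u ^ (-1 - α)) := by
    rw [stableExponent, ← integral_neg, ← RCLike.re_eq_complex_re, ← integral_re hint]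
    refine integral_congr_ae (.of_forall fun u => ?_)
    simp only [RCLike.re_eq_complex_re, hre]
    ring
  have hint' : IntegrableOn (fun u : ℝ => (1 - Real.cos u) * (α * u ^ (-1 - α))) (Ioi 0) := by
    refine hint.re.neg.congr (.of_forall fun u => ?_)
    simp only [Pi.neg_apply, RCLike.re_eq_complex_re, hre]
    ring
  rw [hneg, neg_lt_zero, setIntegral_pos_iff_support_of_nonneg_ae ?_ hint']
  · refine lt_of_lt_of_le (b := volume (Ioo (0 : ℝ) 1)) (by simp) (measure_mono ?_)
    intro u hu
    have : Real.cos u < 1 := by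
      have := Real.cos_lt_cos_of_nonneg_of_le_pi_div_two le_rfl
        (by linarith [hu.2, Real.pi_gt_three]) hu.1
      rwa [Real.cos_zero] at this
    exact ⟨(mul_pos (by linarith) (mul_pos hα0 (Real.rpow_pos_of_pos hu.1 _))).ne', hu.1⟩
  · refine (ae_restrict_iff' measurableSet_Ioi).2 (.of_forall fun u hu => ?_)
    exact mul_nonneg (by linarith [Real.cos_le_one u])
      (mul_nonneg hα0.le (Real.rpow_nonneg (le_of_lt hu) _))

/-! ### The characteristic function under a time shift and under splitting off an innovation -/

lemma one_sub_rpow_pos {α m : ℝ} (hα0 : 0 < α) (hm0 : 0 ≤ m) (hm1 : m < 1) : 0 < 1 - m ^ α :=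
  sub_pos.2 (Real.rpow_lt_one hm0 hm1 hα0)

lemma v_nonneg {α m : ℝ} (hα0 : 0 < α) (hm0 : 0 ≤ m) (hm1 : m < 1) (K : ℕ) (j i : Fin (K + 1)) :
    0 ≤ v α m K j i := by
  have := Real.rpow_nonneg (one_sub_rpow_pos hα0 hm0 hm1).le (-1 / α)
  simp only [v]
  refine mul_nonneg ?_ ?_ <;> split_ifs <;> positivity

lemma levyIntegrand_cons_zero (α : ℝ) {d : ℕ} (θ : EuclideanSpace ℝ (Fin d))
    (w : EuclideanSpace ℝ (Fin (d + 1))) (u : ℝ) :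
    levyIntegrand α (WithLp.toLp 2 (Fin.cons 0 θ.ofLp)) w u =
      levyIntegrand α θ (WithLp.toLp 2 fun i => w i.succ) u := by
  simp [levyIntegrand, PiLp.inner_apply, Fin.sum_univ_succ]

lemma tail_v_zero (α m : ℝ) (K : ℕ) :
    (WithLp.toLp 2 fun i : Fin (K + 1) => v α m (K + 1) 0 i.succ) = m • v α m K 0 := by
  ext i
  simp [v, pow_succ]
  ring

lemma tail_v_one {α m : ℝ} (hα0 : 0 < α) (hm0 : 0 ≤ m) (hm1 : m < 1) (K : ℕ) :
    (WithLp.toLp 2 fun i : Fin (K + 1) => v α m (K + 1) 1 i.succ) =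
      (1 - m ^ α) ^ (1 / α) • v α m K 0 := by
  have h := one_sub_rpow_pos hα0 hm0 hm1
  have hi : (1 - m ^ α) ^ (1 / α) * (1 - m ^ α) ^ (-1 / α) = 1 := by
    rw [← Real.rpow_add h, ← add_div, add_neg_cancel, zero_div, Real.rpow_zero]
  ext i
  have h1 : (1 : Fin (K + 2)) ≤ i.succ := by simp [Fin.le_def]
  simp only [v, h1, PiLp.smul_apply, smul_eq_mul, if_true, Fin.zero_le, ← mul_assoc, hi]
  simp

lemma tail_v_succ_succ (α m : ℝ) (K : ℕ) (j : Fin K) :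
    (WithLp.toLp 2 fun i : Fin (K + 1) => v α m (K + 1) j.succ.succ i.succ) = v α m K j.succ := by
  ext i
  simp [v]

/-- Passing from `(Y_0, …, Y_{K+1})` to `(Y_1, …, Y_{K+1})` turns the first two rays into multiples
of `v_0^{(K)}` by factors whose `α`-th powers `m ^ α` and `1 - m ^ α` add up to `1`. -/
lemma limitCharFun_cons_zero {α m : ℝ} (hα0 : 0 < α) (hm0 : 0 ≤ m) (hm1 : m < 1) (K : ℕ)
    (θ : EuclideanSpace ℝ (Fin (K + 1))) :
    limitCharFun α m (K + 1) (WithLp.toLp 2 (Fin.cons 0 θ.ofLp)) = limitCharFun α m K θ := by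
  have h := one_sub_rpow_pos hα0 hm0 hm1
  have hp : (((1 - m ^ α) ^ (1 / α)) ^ α : ℝ) = 1 - m ^ α := by
    rw [← Real.rpow_mul h.le, one_div_mul_cancel hα0.ne', Real.rpow_one]
  unfold limitCharFun
  congr 2
  rw [Fin.sum_univ_succ, Fin.sum_univ_succ, Fin.sum_univ_succ (n := K)]
  simp_rw [levyIntegrand_cons_zero, tail_v_succ_succ]
  rw [Fin.succ_zero_eq_one, tail_v_zero, tail_v_one hα0 hm0 hm1,
    integral_levyIntegrand_smul hα0 _ _ hm0,
    integral_levyIntegrand_smul hα0 _ _ (Real.rpow_nonneg h.le _), hp]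
  push_cast
  ring

/-- The drift of the innovation at time `n + 1`, up to the factor `1 - m ^ α`. Its independence of `n`
is not needed: it follows from stationarity. -/
def innovationDrift (α m : ℝ) (n : ℕ) : ℝ :=
  ∑ j : Fin (n + 1),
    (drift α (m * v α m n j (Fin.last n)) - m * drift α (v α m n j (Fin.last n)))

/-- The frequency vector at which a vector `z` in `ℝ^{n+2}` is tested in order to test
`(z_0, …, z_n)` at `θ` and `z_{n+1} - m z_n` at `s`. -/
def splitFreq (m : ℝ) {n : ℕ} (θ : EuclideanSpace ℝ (Fin (n + 1))) (s : ℝ) :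
    EuclideanSpace ℝ (Fin (n + 2)) :=
  WithLp.toLp 2 (Fin.snoc (fun i : Fin (n + 1) => θ i - if i = Fin.last n then m * s else 0) s)

lemma sum_splitFreq_mul (m : ℝ) {n : ℕ} (θ : EuclideanSpace ℝ (Fin (n + 1))) (s : ℝ)
    (z : Fin (n + 2) → ℝ) :
    ∑ l, splitFreq m θ s l * z l =
      ∑ i : Fin (n + 1), θ i * z i.castSucc +
        s * (z (Fin.last (n + 1)) - m * z (Fin.last n).castSucc) := by
  simp [splitFreq, Fin.sum_univ_castSucc (n := n + 1), sub_mul, Finset.sum_sub_distrib]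
  ring

lemma inner_splitFreq (m : ℝ) {n : ℕ} (θ : EuclideanSpace ℝ (Fin (n + 1))) (s : ℝ)
    (z : EuclideanSpace ℝ (Fin (n + 2))) :
    ⟪splitFreq m θ s, z⟫ =
      ⟪θ, WithLp.toLp 2 fun i : Fin (n + 1) => z i.castSucc⟫ +
        s * (z (Fin.last (n + 1)) - m * z (Fin.last n).castSucc) := by
  have := sum_splitFreq_mul m θ s z
  simp only [PiLp.inner_apply, RCLike.inner_apply, conj_trivial, mul_comm (z _)] at this ⊢
  exact this

lemma v_castSucc_castSucc (α m : ℝ) (n : ℕ) (j i : Fin (n + 1)) :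
    v α m (n + 1) j.castSucc i.castSucc = v α m n j i := by
  simp [v]

lemma v_castSucc_last (α m : ℝ) (n : ℕ) (j : Fin (n + 1)) :
    v α m (n + 1) j.castSucc (Fin.last (n + 1)) = m * v α m n j (Fin.last n) := by
  have h2 : (n + 1 - (j : ℕ)) = (n - j) + 1 := by omega
  simp only [v, Fin.le_last, Fin.castSucc_eq_zero_iff, Fin.val_last, Fin.val_castSucc, h2, pow_succ,
    if_true]
  ring

lemma v_last_castSucc (α m : ℝ) (n : ℕ) (i : Fin (n + 1)) :
    v α m (n + 1) (Fin.last (n + 1)) i.castSucc = 0 := by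
  simp [v]

lemma v_last_last (α m : ℝ) (n : ℕ) : v α m (n + 1) (Fin.last (n + 1)) (Fin.last (n + 1)) = 1 := by
  simp [v]

/-- The rays `v_0, …, v_n` satisfy `z_{n+1} = m z_n`, hence contribute only a drift in the direction
of the innovation, and the last ray is the unit vector in that direction. So the joint
characteristic function of the past and the innovation factorizes. -/
lemma limitCharFun_splitFreq {α m : ℝ} (hα0 : 0 < α) (hα2 : α < 2) (hm0 : 0 ≤ m) (hm1 : m < 1)
    (n : ℕ) (θ : EuclideanSpace ℝ (Fin (n + 1))) (s : ℝ) :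
    limitCharFun α m (n + 1) (splitFreq m θ s) = limitCharFun α m n θ *
      Complex.exp (((1 - m ^ α : ℝ) : ℂ) *
        (stableExponent α s + Complex.I * ((s * innovationDrift α m n : ℝ) : ℂ))) := by
  have hv := v_nonneg hα0 hm0 hm1
  unfold limitCharFun
  rw [← Complex.exp_add, ← mul_add]
  congr 2
  rw [Fin.sum_univ_castSucc]
  simp_rw [integral_levyIntegrand hα0 hα2 _ _ (hv _ _), sum_splitFreq_mul, inner_splitFreq,
    v_castSucc_castSucc, v_castSucc_last, v_last_castSucc, v_last_last, drift_zero, drift_one,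
    sub_self, mul_zero, add_zero, innovationDrift]
  have h0 : (WithLp.toLp 2 fun _ => 0 : EuclideanSpace ℝ (Fin (n + 1))) = 0 := rfl
  have h1 : ∀ j, (WithLp.toLp 2 fun i => v α m n j i) = v α m n j := fun j => rfl
  simp only [h0, h1, inner_zero_right, zero_add, sub_zero, mul_one, Finset.sum_const_zero,
    Complex.ofReal_zero, mul_zero, add_zero]
  simp only [Complex.ofReal_add, mul_add, Finset.sum_add_distrib, Finset.mul_sum,
    Complex.ofReal_sum]
  ring

/-! ### Stable laws on the line -/

lemma charFun_conv_map_mul (ρ : Measure ℝ) [IsProbabilityMeasure ρ] (a b s : ℝ) :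
    charFun (Measure.conv (ρ.map fun x => a * x) (ρ.map fun x => b * x)) s =
      charFun ρ (a * s) * charFun ρ (b * s) := by
  have : IsProbabilityMeasure (ρ.map fun x => a * x) :=
    Measure.isProbabilityMeasure_map (by fun_prop)
  have : IsProbabilityMeasure (ρ.map fun x => b * x) :=
    Measure.isProbabilityMeasure_map (by fun_prop)
  rw [charFun_conv, charFun_map_mul, charFun_map_mul]

lemma charFun_map_affine (ρ : Measure ℝ) (C c s : ℝ) :
    charFun (ρ.map fun x => C * x + c) s = charFun ρ (C * s) * Complex.exp (((c * s : ℝ) : ℂ) *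
      Complex.I) := by
  have : (fun x => C * x + c) = (fun x => x + c) ∘ fun x : ℝ => C * x := rfl
  rw [this, ← Measure.map_map (by fun_prop) (by fun_prop), charFun_map_add_const, charFun_map_mul]
  simp [mul_comm]

/-- A law with a stable exponent, scaled and shifted, is `α`-stable. It is not a Dirac measure
because its characteristic function has modulus less than `1` at the frequency `1`. -/
lemma isAlphaStable_of_charFun {α : ℝ} (hα0 : 0 < α) (hα2 : α < 2) {r D : ℝ} (hr : 0 < r)
    (ρ : Measure ℝ) [IsProbabilityMeasure ρ]
    (hρ : ∀ s, charFun ρ s =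
      Complex.exp ((r : ℂ) * (stableExponent α s + Complex.I * ((s * D : ℝ) : ℂ)))) :
    IsAlphaStable α ρ := by
  refine ⟨inferInstance, fun x hx => ?_, fun a b ha hb => ?_⟩
  · -- the characteristic function of a Dirac measure has modulus `1`
    have h1 : ‖charFun ρ 1‖ = 1 := by
      rw [hx, charFun_dirac, Complex.norm_exp_ofReal_mul_I]
    rw [hρ, Complex.norm_exp, Real.exp_eq_one_iff] at h1
    simp only [Complex.re_ofReal_mul, Complex.add_re, Complex.I_mul_re, Complex.ofReal_im, neg_zero,
      add_zero] at h1
    exact (mul_neg_of_pos_of_neg hr (re_stableExponent_one_neg hα0 hα2)).ne h1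
  · set C := (a ^ α + b ^ α) ^ (1 / α) with hC
    have hab : 0 < a ^ α + b ^ α := by positivity
    have hC0 : 0 ≤ C := Real.rpow_nonneg hab.le _
    have hCα : C ^ α = a ^ α + b ^ α := by
      rw [hC, ← Real.rpow_mul hab.le, one_div_mul_cancel hα0.ne', Real.rpow_one]
    -- the drifts produced by the scalings by `a`, `b` and `C` are linear in the frequency
    refine ⟨r * (D * (a + b - C) - drift α a - drift α b + drift α C), ?_⟩
    have : IsProbabilityMeasure (ρ.map fun x => a * x) :=
      Measure.isProbabilityMeasure_map (by fun_prop)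
    have : IsProbabilityMeasure (ρ.map fun x => b * x) :=
      Measure.isProbabilityMeasure_map (by fun_prop)
    have : IsProbabilityMeasure (ρ.map fun x => C * x +
        r * (D * (a + b - C) - drift α a - drift α b + drift α C)) :=
      Measure.isProbabilityMeasure_map (by fun_prop)
    refine Measure.ext_of_charFun (funext fun s => ?_)
    rw [charFun_conv_map_mul, charFun_map_affine, hρ, hρ, hρ, ← Complex.exp_add, ← Complex.exp_add,
      stableExponent_mul hα0 hα2 ha.le, stableExponent_mul hα0 hα2 hb.le,
      stableExponent_mul hα0 hα2 hC0, hCα]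
    congr 1
    push_cast
    ring

/-! ### Stationarity -/

variable {Ω : Type*} [MeasurableSpace Ω]

/-- The segment `(Y_0, …, Y_K)` as a vector of the Euclidean space. -/
def segment (Y : ℕ → Ω → ℝ) (K : ℕ) (ω : Ω) : EuclideanSpace ℝ (Fin (K + 1)) :=
  WithLp.toLp 2 fun i => Y i ω

lemma measurable_segment {Y : ℕ → Ω → ℝ} (hY : ∀ k, Measurable (Y k)) (K : ℕ) :
    Measurable (segment Y K) :=
  (WithLp.measurable_toLp 2 _).comp (measurable_pi_lambda _ fun i => hY i)

lemma charFun_map_eq_of_inner {E F : Type*} [NormedAddCommGroup E] [InnerProductSpace ℝ E]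
    [MeasurableSpace E] [BorelSpace E] [SecondCountableTopology E]
    [NormedAddCommGroup F] [InnerProductSpace ℝ F]
    [MeasurableSpace F] [BorelSpace F] [SecondCountableTopology F]
    {P : Measure Ω} {X : Ω → E} {Z : Ω → F} (hX : Measurable X) (hZ : Measurable Z) {t : E} {s : F}
    (h : ∀ ω, ⟪X ω, t⟫ = ⟪Z ω, s⟫) : charFun (P.map X) t = charFun (P.map Z) s := by
  rw [charFun_apply, charFun_apply, integral_map hX.aemeasurable (by fun_prop),
    integral_map hZ.aemeasurable (by fun_prop)]
  simp_rw [h]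

lemma identDistrib_segment_shift {P : Measure Ω} [IsProbabilityMeasure P] {α m : ℝ} (hα0 : 0 < α)
    (hm0 : 0 ≤ m) (hm1 : m < 1) {Y : ℕ → Ω → ℝ} (hY : IsLimitProcess P α m Y) (K : ℕ) :
    IdentDistrib (segment (fun k => Y (k + 1)) K) (segment Y K) P P := by
  have h0 := measurable_segment hY.measurable
  have h1 := measurable_segment (fun k => hY.measurable (k + 1)) K
  have := Measure.isProbabilityMeasure_map (μ := P) h1.aemeasurable
  have := Measure.isProbabilityMeasure_map (μ := P) (h0 K).aemeasurable
  refine ⟨h1.aemeasurable, (h0 K).aemeasurable, Measure.ext_of_charFun (funext fun θ => ?_)⟩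
  refine Eq.trans ?_ ((limitCharFun_cons_zero hα0 hm0 hm1 K θ).trans (hY.charFun_eq K θ).symm)
  rw [← hY.charFun_eq (K + 1)]
  refine charFun_map_eq_of_inner h1 (h0 (K + 1)) fun ω => ?_
  simp [segment, PiLp.inner_apply, Fin.sum_univ_succ (n := K + 1)]

lemma isStronglyStationary {P : Measure Ω} [IsProbabilityMeasure P] {α m : ℝ} (hα0 : 0 < α)
    (hm0 : 0 ≤ m) (hm1 : m < 1) {Y : ℕ → Ω → ℝ} (hY : IsLimitProcess P α m Y) :
    IsStronglyStationary P Y := by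
  have hm : ∀ h, Measurable fun ω k => Y (k + h) ω :=
    fun h => measurable_pi_lambda _ fun k => hY.measurable _
  have hone : IdentDistrib (fun ω k => Y (k + 1) ω) (fun ω k => Y k ω) P P := by
    refine (identDistrib_iff_forall_finset_identDistrib (X := fun k => Y (k + 1)) (Y := Y)
      (hm 1).aemeasurable (hm 0).aemeasurable).2 fun I => ?_
    have hI : ∀ i : I, (i : ℕ) < I.sup id + 1 :=
      fun i => Nat.lt_succ_of_le (Finset.le_sup (f := id) i.2)
    exact (identDistrib_segment_shift hα0 hm0 hm1 hY (I.sup id)).comp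
      (u := fun z (i : I) => z ⟨i, hI i⟩) (by fun_prop)
  intro h
  induction h with
  | zero => exact IdentDistrib.refl (hm 0).aemeasurable
  | succ h ih =>
    have := ih.comp (u := fun y : ℕ → ℝ => fun k => y (k + 1)) (by fun_prop)
    refine IdentDistrib.trans ?_ (this.trans hone)
    have he : (fun ω k => Y (k + (h + 1)) ω) =
        (fun y : ℕ → ℝ => fun k => y (k + 1)) ∘ fun ω k => Y (k + h) ω := by
      ext ω k
      exact congrArg (Y · ω) (by omega)
    rw [he]
    exact IdentDistrib.refl (he ▸ (hm (h + 1)).aemeasurable)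

/-! ### The innovations -/

lemma measurable_innovation {Y : ℕ → Ω → ℝ} (hY : ∀ k, Measurable (Y k)) (m : ℝ) (k : ℕ) :
    Measurable (innovation m Y k) :=
  (hY k).sub ((hY (k - 1)).const_mul m)

lemma inner_segment_splitFreq {Ω : Type*} (m : ℝ) (Y : ℕ → Ω → ℝ) (n : ℕ)
    (θ : EuclideanSpace ℝ (Fin (n + 1))) (s : ℝ) (ω : Ω) :
    ⟪segment Y (n + 1) ω, splitFreq m θ s⟫ =
      innovation m Y (n + 1) ω * s + ⟪segment Y n ω, θ⟫ := by
  rw [real_inner_comm, inner_splitFreq, real_inner_comm, add_comm, mul_comm]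
  rfl

lemma charFun_innovation {P : Measure Ω} [IsProbabilityMeasure P] {α m : ℝ} (hα0 : 0 < α)
    (hα2 : α < 2) (hm0 : 0 ≤ m) (hm1 : m < 1) {Y : ℕ → Ω → ℝ} (hY : IsLimitProcess P α m Y)
    (n : ℕ) (s : ℝ) :
    charFun (P.map (innovation m Y (n + 1))) s = Complex.exp (((1 - m ^ α : ℝ) : ℂ) *
      (stableExponent α s + Complex.I * ((s * innovationDrift α m n : ℝ) : ℂ))) := by
  have h1 := limitCharFun_splitFreq hα0 hα2 hm0 hm1 n 0 s
  have := Measure.isProbabilityMeasure_map (μ := P)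
    (measurable_segment hY.measurable n).aemeasurable
  have h0 : limitCharFun α m n 0 = 1 := by
    rw [← hY.charFun_eq]
    exact (charFun_zero (P.map (segment Y n))).trans (by simp)
  rw [h0, one_mul, ← hY.charFun_eq] at h1
  rw [← h1]
  refine charFun_map_eq_of_inner (measurable_innovation hY.measurable m _)
    (measurable_segment hY.measurable _) fun ω => ?_
  rw [inner_segment_splitFreq, inner_zero_right, add_zero]
  simp [mul_comm]

lemma indepFun_innovation_segment {P : Measure Ω} [IsProbabilityMeasure P] {α m : ℝ} (hα0 : 0 < α)
    (hα2 : α < 2) (hm0 : 0 ≤ m) (hm1 : m < 1) {Y : ℕ → Ω → ℝ} (hY : IsLimitProcess P α m Y)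
    (n : ℕ) : IndepFun (innovation m Y (n + 1)) (segment Y n) P := by
  have hε := measurable_innovation hY.measurable m (n + 1)
  have hs := measurable_segment hY.measurable
  refine (indepFun_iff_charFun_prod hε.aemeasurable (hs n).aemeasurable).2 fun t => ?_
  rw [charFun_innovation hα0 hα2 hm0 hm1 hY]
  refine Eq.trans ?_ (((hY.charFun_eq (n + 1) _).trans
    (limitCharFun_splitFreq hα0 hα2 hm0 hm1 n t.ofLp.2 t.ofLp.1)).trans ?_)
  · refine charFun_map_eq_of_inner (by fun_prop) (hs (n + 1)) fun ω => ?_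
    rw [inner_segment_splitFreq, WithLp.prod_inner_apply]
    simp [mul_comm]
  · rw [mul_comm, ← hY.charFun_eq]
    rfl

lemma indepFun_innovation_past {P : Measure Ω} [IsProbabilityMeasure P] {α m : ℝ} (hα0 : 0 < α)
    (hα2 : α < 2) (hm0 : 0 ≤ m) (hm1 : m < 1) {Y : ℕ → Ω → ℝ} (hY : IsLimitProcess P α m Y)
    (n : ℕ) : IndepFun (innovation m Y (n + 1)) (fun ω (i : Fin (n + 1)) => Y i ω) P :=
  (indepFun_innovation_segment hα0 hα2 hm0 hm1 hY n).comp measurable_id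
    (WithLp.measurable_ofLp 2 _)

/-- An innovation independent of all earlier values of the process is independent of the earlier
innovations, so the innovations are independent by induction on the largest index. -/
lemma iIndepFun_innovation {P : Measure Ω} [IsProbabilityMeasure P] {m : ℝ} {Y : ℕ → Ω → ℝ}
    (h : ∀ k : ℕ, 1 ≤ k → IndepFun (innovation m Y k) (fun ω (i : Fin k) => Y i ω) P) :
    iIndepFun (fun k : {k : ℕ // 1 ≤ k} => innovation m Y k) P := by
  refine iIndepFun_iff_measure_inter_preimage_eq_mul.2 fun S sets => ?_
  refine Finset.induction_on_max S (by simp) fun a S ha ih hsets => ?_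
  have haS : a ∉ S := fun h => (ha a h).false
  rw [Finset.prod_insert haS, ← ih fun i hi => hsets i (Finset.mem_insert_of_mem hi),
    Finset.set_biInter_insert]
  refine (IndepFun_iff _ _ _).1 (h a a.2) _ _
    ⟨_, hsets a (Finset.mem_insert_self _ _), rfl⟩ ?_
  refine Finset.measurableSet_biInter _ fun i hi => ?_
  have hlt : (i : ℕ) < a := ha i hi
  have hlt' : (i : ℕ) - 1 < a := by omega
  exact ⟨{z | z ⟨i, hlt⟩ - m * z ⟨i - 1, hlt'⟩ ∈ sets i},
    (by fun_prop : Measurable fun z : Fin a → ℝ => z ⟨i, hlt⟩ - m * z ⟨i - 1, hlt'⟩)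
      (hsets i (Finset.mem_insert_of_mem hi)), rfl⟩

lemma identDistrib_innovation {P : Measure Ω} {m : ℝ} {Y : ℕ → Ω → ℝ}
    (h : IsStronglyStationary P Y) {k : ℕ} (hk : 1 ≤ k) :
    IdentDistrib (innovation m Y k) (innovation m Y 1) P P := by
  have := (h (k - 1)).comp (u := fun y : ℕ → ℝ => y 1 - m * y 0) (by fun_prop)
  have hl : innovation m Y k =
      (fun y : ℕ → ℝ => y 1 - m * y 0) ∘ fun ω i => Y (i + (k - 1)) ω := by
    ext ω
    simp [innovation, Nat.add_sub_cancel' hk]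
  rw [hl]
  exact this

/-! ### The Markov property -/

/-- The transition kernel of the autoregression with innovation law `ρ`: it sends `x` to the law of
`m x + ε`, where `ε` has law `ρ`. -/
def arKernel (m : ℝ) (ρ : Measure ℝ) : Kernel ℝ ℝ :=
  (Kernel.id ×ₖ Kernel.const ℝ ρ).map fun p : ℝ × ℝ => m * p.1 + p.2

instance (m : ℝ) (ρ : Measure ℝ) [IsProbabilityMeasure ρ] : IsMarkovKernel (arKernel m ρ) :=
  Kernel.IsMarkovKernel.map _ (by fun_prop)

lemma arKernel_apply (m : ℝ) (ρ : Measure ℝ) [IsProbabilityMeasure ρ] (x : ℝ) {B : Set ℝ}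
    (hB : MeasurableSet B) : arKernel m ρ x B = ρ {e | m * x + e ∈ B} := by
  have hf : Measurable fun p : ℝ × ℝ => m * p.1 + p.2 := by fun_prop
  rw [arKernel, Kernel.map_apply' _ hf _ hB, Kernel.id_prod_apply' _ _ (hf hB)]
  rfl

/-- The conditional law of the next value of an autoregression, given the past. -/
lemma map_prodMk_eq_compProd {P : Measure Ω} [IsProbabilityMeasure P] {β : Type*}
    [MeasurableSpace β] {X : Ω → β} {ε : Ω → ℝ} (hX : Measurable X) (hε : Measurable ε)
    (hind : IndepFun X ε P) (m : ℝ) {g : β → ℝ} (hg : Measurable g) :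
    P.map (fun ω => (X ω, m * g (X ω) + ε ω)) =
      P.map X ⊗ₘ (arKernel m (P.map ε)).comap g hg := by
  have := Measure.isProbabilityMeasure_map (μ := P) hX.aemeasurable
  have := Measure.isProbabilityMeasure_map (μ := P) hε.aemeasurable
  have hF : Measurable fun p : β × ℝ => (p.1, m * g p.1 + p.2) := by fun_prop
  have hc : (fun ω => (X ω, m * g (X ω) + ε ω)) =
      (fun p : β × ℝ => (p.1, m * g p.1 + p.2)) ∘ fun ω => (X ω, ε ω) := rfl
  ext s hs
  rw [hc, ← Measure.map_map hF (hX.prodMk hε),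
    (indepFun_iff_map_prod_eq_prod_map_map hX.aemeasurable hε.aemeasurable).1 hind,
    Measure.map_apply hF hs, Measure.prod_apply (hF hs), Measure.compProd_apply hs]
  refine lintegral_congr fun x => ?_
  rw [Kernel.comap_apply, arKernel_apply _ _ _ (measurable_prodMk_left hs)]
  rfl

lemma isTimeHomogeneousMarkov {P : Measure Ω} [IsProbabilityMeasure P] {m : ℝ} {Y : ℕ → Ω → ℝ}
    (hY : ∀ k, Measurable (Y k)) (hst : IsStronglyStationary P Y)
    (hind : ∀ k : ℕ, 1 ≤ k → IndepFun (innovation m Y k) (fun ω (i : Fin k) => Y i ω) P) :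
    IsTimeHomogeneousMarkov P Y := by
  have hε := measurable_innovation hY m
  have := Measure.isProbabilityMeasure_map (μ := P) (hε 1).aemeasurable
  refine ⟨arKernel m (P.map (innovation m Y 1)), inferInstance, fun k B hB => ?_⟩
  have hX : Measurable fun ω (i : Fin (k + 1)) => Y i ω :=
    measurable_pi_lambda _ fun i => hY i
  have hrec : Y (k + 1) = fun ω => m * Y k ω + innovation m Y (k + 1) ω := by
    ext ω; simp [innovation]
  have hg : Measurable fun z : Fin (k + 1) → ℝ => z (Fin.last k) := by fun_prop
  have hjoint := map_prodMk_eq_compProd hX (hε (k + 1)) (hind (k + 1) (by omega)).symm m hg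
  rw [(identDistrib_innovation hst (by omega)).map_eq] at hjoint
  have hcond := condDistrib_ae_eq_of_measure_eq_compProd_of_measurable (μ := P) hX (hY (k + 1))
    (by rw [← hjoint, hrec]; rfl)
  have hexp := condDistrib_ae_eq_condExp (μ := P) hX (hY (k + 1)) hB
  filter_upwards [hexp, ae_of_ae_map hX.aemeasurable hcond] with ω h1 h2
  rw [← h1, h2, Kernel.comap_apply]
  rfl

end GWIAggregation

end

theorem proposition2p6 {Ω : Type*} [MeasurableSpace Ω] (P : Measure Ω) [IsProbabilityMeasure P]
    (α m : ℝ) (hα0 : 0 < α) (hα2 : α < 2) (hm0 : 0 ≤ m) (hm1 : m < 1)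
    (Y : ℕ → Ω → ℝ) (hY : GWIAggregation.IsLimitProcess P α m Y) :
    -- the autoregressive recursion of order 1
    (∀ k : ℕ, 1 ≤ k → ∀ ω, Y k ω = m * Y (k - 1) ω + GWIAggregation.innovation m Y k ω) ∧
    -- the innovations are independent
    iIndepFun (fun k : {k : ℕ // 1 ≤ k} => GWIAggregation.innovation m Y k) P ∧
    -- identically distributed
    (∀ k l : ℕ, 1 ≤ k → 1 ≤ l →
      IdentDistrib (GWIAggregation.innovation m Y k) (GWIAggregation.innovation m Y l) P P) ∧
    -- and stable with index α
    (∀ k : ℕ, 1 ≤ k →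
      GWIAggregation.IsAlphaStable α (P.map (GWIAggregation.innovation m Y k))) ∧
    -- each innovation is independent of the vector of the earlier values of the process
    (∀ k : ℕ, 1 ≤ k →
      IndepFun (GWIAggregation.innovation m Y k) (fun ω (i : Fin k) => Y i ω) P) ∧
    -- the process is a strongly stationary, time homogeneous Markov process
    GWIAggregation.IsStronglyStationary P Y ∧
    GWIAggregation.IsTimeHomogeneousMarkov P Y := by
  have hind : ∀ k : ℕ, 1 ≤ k → IndepFun (GWIAggregation.innovation m Y k)
      (fun ω (i : Fin k) => Y i ω) P := by
    intro k hk
    obtain ⟨n, rfl⟩ := Nat.exists_eq_add_of_le' hk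
    exact GWIAggregation.indepFun_innovation_past hα0 hα2 hm0 hm1 hY n
  have hst := GWIAggregation.isStronglyStationary hα0 hm0 hm1 hY
  refine ⟨fun k _ ω => by simp [GWIAggregation.innovation],
    GWIAggregation.iIndepFun_innovation hind,
    fun k l hk hl => (GWIAggregation.identDistrib_innovation hst hk).trans
      (GWIAggregation.identDistrib_innovation hst hl).symm,
    fun k hk => ?_, hind, hst, GWIAggregation.isTimeHomogeneousMarkov hY.measurable hst hind⟩
  obtain ⟨n, rfl⟩ := Nat.exists_eq_add_of_le' hk
  have := Measure.isProbabilityMeasure_map (μ := P)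
    (GWIAggregation.measurable_innovation hY.measurable m (n + 1)).aemeasurable
  exact GWIAggregation.isAlphaStable_of_charFun hα0 hα2
    (GWIAggregation.one_sub_rpow_pos hα0 hm0 hm1) _
    (GWIAggregation.charFun_innovation hα0 hα2 hm0 hm1 hY n)
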